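/- Let $\mathcal{L}\subset\mathbb{R}^d$ be a lattice (a discrete additive subgroup, not necessarily of full rank), and let $P\subset\mathbb{R}^d$ be a lattice polytope, i.e. the convex hull of a nonempty finite subset of $\mathcal{L}$. The lattice points of $P$ are the elements of $P\cap\mathcal{L}$. For an ordering $p_1,\dots,p_k$ of all the lattice points of $P$, the induced pulling triangulation $\Delta_{pull}(P)$ is defined recursively: if $p_1,\dots,p_k$ are affinely independent, then $\Delta_{pull}(P)=\{\{p_1,\dots,p_k\}\}$; otherwise $$\Delta_{pull}(P)=\bigcup_F\{\{p_1\}\cup\sigma \mid \sigma\in\Delta_{pull}(F)\},$$ where $F$ runs over the facets of $P$ not containing $p_1$, and the lattice points of $F$ carry the induced ordering. A triangulation of $P$ is unimodular if each of its (maximal) simplices attains the minimal $(\dim P)$-dimensional volume among all simplices of dimension $\dim P$ whose vertices are lattice points of $P$. The polytope $P$ is compressed if all its pulling triangulations are unimodular. Let $\Gamma$ be the group of affine symmetries of $P$, i.e. of the affine automorphisms $g$ of $\mathbb{R}^d$ with $g(P)=P$, and suppose that $\Gamma$ is transitive on the lattice points of $P$: for all $p,q\in P\cap\mathcal{L}$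 there is $g\in\Gamma$ with $g(p)=q$. Then either $P$ is compressed or no pulling triangulation of $P$ is unimodular. -/

import Mathlib

open MeasureTheory

noncomputable section

namespace LatticePolytope

variable {d : ℕ}

/-- A lattice polytope: the convex hull of a nonempty finite set of points of the lattice `L`. -/
def IsLatticePolytope (L : Submodule ℤ (EuclideanSpace ℝ (Fin d)))
    (P : Set (EuclideanSpace ℝ (Fin d))) : Prop :=
  ∃ s : Finset (EuclideanSpace ℝ (Fin d)),
    s.Nonempty ∧ (∀ x ∈ s, x ∈ L) ∧ P = convexHull ℝ (s : Set (EuclideanSpace ℝ (Fin d)))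

/-- The lattice points of `P`. -/
def latticePoints (L : Submodule ℤ (EuclideanSpace ℝ (Fin d)))
    (P : Set (EuclideanSpace ℝ (Fin d))) : Set (EuclideanSpace ℝ (Fin d)) :=
  {x | x ∈ P ∧ x ∈ L}

/-- The dimension of a (nonempty) polytope: the dimension of its affine hull. -/
def dim (P : Set (EuclideanSpace ℝ (Fin d))) : ℕ :=
  Module.finrank ℝ (vectorSpan ℝ P)

/-- A facet of `P`: a nonempty face (the set of maximizers on `P` of a linear functional)
of dimension one less than that of `P`. -/
def IsFacet (P F : Set (EuclideanSpace ℝ (Fin d))) : Prop :=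
  F.Nonempty ∧ IsExposed ℝ P F ∧ dim F + 1 = dim P

open Classical in
/-- The collection of (vertex sets of) maximal simplices of the pulling triangulation of `P`
induced by the ordered list `l` of its lattice points. -/
def pullingTriangulation (P : Set (EuclideanSpace ℝ (Fin d))) :
    List (EuclideanSpace ℝ (Fin d)) → Set (Set (EuclideanSpace ℝ (Fin d)))
  | [] => {∅}
  | p :: l =>
    if AffineIndependent ℝ
        (Subtype.val : {x | x ∈ p :: l} → EuclideanSpace ℝ (Fin d)) then
      {{x | x ∈ p :: l}}
    else
      {τ | ∃ F, IsFacet P F ∧ p ∉ F ∧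
        ∃ σ ∈ pullingTriangulation F (l.filter (fun x => x ∈ F)), τ = insert p σ}
termination_by l => l.length
decreasing_by
  rw [List.length_unattach, List.length_cons]
  exact Nat.lt_succ_of_le ((List.length_filter_le _ _).trans List.length_attach.le)

/-- `l` lists every lattice point of `P` exactly once. -/
def IsLatticePointOrdering (L : Submodule ℤ (EuclideanSpace ℝ (Fin d)))
    (P : Set (EuclideanSpace ℝ (Fin d))) (l : List (EuclideanSpace ℝ (Fin d))) : Prop :=
  l.Nodup ∧ ∀ x, x ∈ l ↔ x ∈ latticePoints L P

/-- `T` is a pulling triangulation of `P` using the lattice points of `P`. -/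
def IsPullingTriangulation (L : Submodule ℤ (EuclideanSpace ℝ (Fin d)))
    (P : Set (EuclideanSpace ℝ (Fin d))) (T : Set (Set (EuclideanSpace ℝ (Fin d)))) : Prop :=
  ∃ l, IsLatticePointOrdering L P l ∧ T = pullingTriangulation P l

/-- `σ` is the vertex set of a simplex of dimension `dim P` whose vertices are lattice points
of `P`. -/
def IsLatticeSimplex (L : Submodule ℤ (EuclideanSpace ℝ (Fin d)))
    (P : Set (EuclideanSpace ℝ (Fin d))) (σ : Set (EuclideanSpace ℝ (Fin d))) : Prop :=
  σ ⊆ latticePoints L P ∧ σ.ncard = dim P + 1 ∧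
    AffineIndependent ℝ (Subtype.val : σ → EuclideanSpace ℝ (Fin d))

/-- A triangulation of `P` is unimodular if each of its simplices attains the minimal volume
among all simplices (of the dimension of `P`) spanned by lattice points of `P`. The volume is the
Euclidean volume in dimension `dim P`. -/
def IsUnimodular (L : Submodule ℤ (EuclideanSpace ℝ (Fin d)))
    (P : Set (EuclideanSpace ℝ (Fin d))) (T : Set (Set (EuclideanSpace ℝ (Fin d)))) : Prop :=
  ∀ σ ∈ T, IsLeast {v | ∃ τ, IsLatticeSimplex L P τ ∧ v = μHE[dim P] (convexHull ℝ τ)}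
    (μHE[dim P] (convexHull ℝ σ))

/-- `P` is compressed if all its pulling triangulations are unimodular. -/
def IsCompressed (L : Submodule ℤ (EuclideanSpace ℝ (Fin d)))
    (P : Set (EuclideanSpace ℝ (Fin d))) : Prop :=
  ∀ T, IsPullingTriangulation L P T → IsUnimodular L P T

/-- The group of affine symmetries of `P`. -/
def affineSymmetryGroup (P : Set (EuclideanSpace ℝ (Fin d))) :
    Subgroup (EuclideanSpace ℝ (Fin d) ≃ᵃ[ℝ] EuclideanSpace ℝ (Fin d)) where
  carrier := {g | g '' P = P}
  one_mem' := by simp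
  mul_mem' := by
    intro a b ha hb
    simp only [Set.mem_ofPred_eq] at ha hb ⊢
    rw [AffineEquiv.coe_mul, Set.image_comp, hb, ha]
  inv_mem' := by
    intro a ha
    simp only [Set.mem_ofPred_eq] at ha ⊢
    conv_lhs => rw [← ha]
    rw [← Set.image_comp, ← AffineEquiv.coe_mul, inv_mul_cancel]
    simp

end LatticePolytope

end

/-! The two alternatives are linked by a condition on the lattice points V of P, `IsTwoLevel`: each
functional cutting out a facet takes only one nonzero value on V.

A unimodular pulling triangulation forces two levels. Let p be pulled first, with V not affinely
independent. Over each facet F missing p the triangulation contains a simplex with apex p and base σ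
in F. Replacing p by another lattice point q off F multiplies the volume by the ratio of the heights
over F, so p has the least positive height. Transitivity makes V the vertex set of P, so symmetries
permute V even if they do not preserve the lattice. Carrying p to any other point shows that all
points off a given facet have the same height (`isTwoLevel_of_isUnimodular`).

Two levels force compressedness. By induction along the pulling, the edges of each simplex generate
over ℤ all differences of points of V: with f normalized to values 0 and 1, p the apex and r a
vertex of the base, subtracting f(x)(p - r) from x lands in the hyperplane of the facet. The new
point may leave V, so the induction runs over `integralPoints`. The edges of any other lattice
simplex are then integer combinations of these edges, with nonzero integer determinant, so its
volume is no smaller (`isCompressed_of_isTwoLevel`).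

If V is affinely independent, there is only one pulling triangulation. -/

noncomputable section

namespace LatticePolytope

/-! ### Volumes of simplices through determinants of edge vectors -/

section Volume

variable {E : Type*} [NormedAddCommGroup E] [InnerProductSpace ℝ E] {n : ℕ}

/-- The linear map sending the standard basis of `ℝⁿ` to a given family of vectors. -/
def edgeMap (v : Fin n → E) : EuclideanSpace ℝ (Fin n) →ₗ[ℝ] E :=
  (EuclideanSpace.basisFun (Fin n) ℝ).toBasis.constr ℝ v

@[simp]
theorem edgeMap_single (v : Fin n → E) (i : Fin n) :
    edgeMap v (EuclideanSpace.single i 1) = v i := by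
  rw [edgeMap, ← EuclideanSpace.basisFun_apply, ← OrthonormalBasis.coe_toBasis,
    Module.Basis.constr_basis]

theorem edgeMap_comp {m : ℕ} (v : Fin n → E) (w : Fin m → EuclideanSpace ℝ (Fin n)) :
    edgeMap v ∘ₗ edgeMap w = edgeMap (fun i => edgeMap v (w i)) := by
  refine (EuclideanSpace.basisFun (Fin m) ℝ).toBasis.ext fun i => ?_
  simp

theorem edgeMap_apply (v : Fin n → E) (x : EuclideanSpace ℝ (Fin n)) :
    edgeMap v x = ∑ i, x i • v i := by
  simp [edgeMap, Module.Basis.constr_apply_fintype]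

theorem ker_edgeMap {v : Fin n → E} (hv : LinearIndependent ℝ v) : (edgeMap v).ker = ⊥ := by
  rw [LinearMap.ker_eq_bot']
  intro x hx
  rw [edgeMap_apply] at hx
  ext i
  exact Fintype.linearIndependent_iff.1 hv _ hx i

/-- The corner simplex in `ℝⁿ`. -/
def cornerSimplex (n : ℕ) : Set (EuclideanSpace ℝ (Fin n)) :=
  convexHull ℝ (insert 0 (Set.range (EuclideanSpace.basisFun (Fin n) ℝ)))

theorem volume_cornerSimplex_ne_zero : volume (cornerSimplex n) ≠ 0 := by
  have h : (interior (cornerSimplex n)).Nonempty := by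
    rw [cornerSimplex, interior_convexHull_nonempty_iff_affineSpan_eq_top,
      AffineSubspace.affineSpan_eq_top_iff_vectorSpan_eq_top_of_nonempty _ _ _
        (Set.insert_nonempty _ _),
      vectorSpan_eq_span_vsub_set_right ℝ (Set.mem_insert _ _), eq_top_iff,
      ← (EuclideanSpace.basisFun (Fin n) ℝ).toBasis.span_eq]
    refine Submodule.span_mono ?_
    rintro _ ⟨i, rfl⟩
    exact ⟨_, Set.mem_insert_of_mem _ ⟨i, rfl⟩, by simp⟩
  exact (Measure.measure_pos_of_nonempty_interior _ h).ne'

theorem volume_cornerSimplex_ne_top : volume (cornerSimplex n) ≠ ⊤ := by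
  refine (IsCompact.measure_lt_top ?_).ne
  exact Set.Finite.isCompact_convexHull ℝ ((Set.finite_range _).insert 0)

/-- The simplex is a translate of the linear image of the corner simplex, and E may have dimension
larger than n. Comparing volumes thus reduces to comparing `normDet`. -/
theorem measure_convexHull_eq [MeasurableSpace E] [BorelSpace E] (q : E) (v : Fin n → E) :
    μHE[n] (convexHull ℝ (insert q (Set.range fun i => q + v i))) =
      ENNReal.ofReal (edgeMap v).normDet * volume (cornerSimplex n) := by
  have h1 : insert q (Set.range fun i => q + v i) = (fun x => q + x) ''
      (edgeMap v '' insert 0 (Set.range (EuclideanSpace.basisFun (Fin n) ℝ))) := by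
    simp only [Set.image_insert_eq, map_zero, add_zero]
    congr 1
    rw [← Set.range_comp, ← Set.range_comp]
    congr 1
    ext i
    simp
  have h2 : convexHull ℝ (insert q (Set.range fun i => q + v i)) =
      (fun x => q + x) '' (edgeMap v '' cornerSimplex n) := by
    rw [h1, cornerSimplex, LinearMap.image_convexHull]
    exact convexHull_vadd (𝕜 := ℝ) q
      (edgeMap v '' insert 0 (Set.range (EuclideanSpace.basisFun (Fin n) ℝ)))
  rw [h2, (isometry_add_left q).euclideanHausdorffMeasure_image]
  have := (edgeMap v).euclideanHausdorffMeasure_image_eq_normDet_mul_volume (cornerSimplex n)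
  rwa [finrank_euclideanSpace_fin] at this

/-- The map of w factors as the map of v after an integer matrix. Independence of w makes its
determinant nonzero, hence at least 1 in absolute value. -/
theorem normDet_edgeMap_le {v w : Fin n → E} (hw : LinearIndependent ℝ w)
    (h : ∀ i, w i ∈ Submodule.span ℤ (Set.range v)) :
    (edgeMap v).normDet ≤ (edgeMap w).normDet := by
  choose c hc using fun i => (Submodule.mem_span_range_iff_exists_fun ℤ).1 (h i)
  let M : Matrix (Fin n) (Fin n) ℤ := Matrix.of fun i j => c j i
  let u : Fin n → EuclideanSpace ℝ (Fin n) := fun i => WithLp.toLp 2 fun j => (c i j : ℝ)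
  have hu : edgeMap v ∘ₗ edgeMap u = edgeMap w := by
    rw [edgeMap_comp]
    congr 1
    ext1 i
    rw [edgeMap_apply, ← hc i]
    simp [u, Int.cast_smul_eq_zsmul]
  have hM : (edgeMap u).det = (M.det : ℝ) := by
    rw [← LinearMap.det_toMatrix (EuclideanSpace.basisFun (Fin n) ℝ).toBasis,
      show (M.det : ℝ) = (Int.castRingHom ℝ) M.det from rfl, RingHom.map_det]
    congr 1
    ext i j
    simp [LinearMap.toMatrix_apply, M, u]
  have hdet : (edgeMap u).det ≠ 0 := by
    intro h0
    have hlt := LinearMap.bot_lt_ker_of_det_eq_zero h0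
    have hk := ker_edgeMap hw
    rw [← hu] at hk
    exact hlt.ne' (le_bot_iff.1 (hk ▸ LinearMap.ker_le_ker_comp _ _))
  have h1 : (1 : ℝ) ≤ |(edgeMap u).det| := by
    rw [hM] at hdet ⊢
    rw [← Int.cast_abs]
    exact_mod_cast Int.one_le_abs (by exact_mod_cast hdet)
  rw [← hu, LinearMap.normDet_comp_of_finrank_eq _ _ rfl, LinearMap.normDet_eq_abs_det]
  exact le_mul_of_one_le_right (LinearMap.normDet_nonneg _) h1

theorem normDet_edgeMap_update (v : Fin n → E) (k : Fin n) (c : Fin n → ℝ) :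
    (edgeMap (Function.update v k (∑ i, c i • v i))).normDet =
      (edgeMap v).normDet * |c k| := by
  let e := EuclideanSpace.basisFun (Fin n) ℝ
  -- A sends the k-th basis vector to c and fixes the others, so its determinant is 1 + (c k - 1) =
  -- c k.
  let A := LinearMap.transvection (R := ℝ) (e.toBasis.coord k) (WithLp.toLp 2 c - e k)
  have hA : edgeMap v ∘ₗ A = edgeMap (Function.update v k (∑ i, c i • v i)) := by
    refine e.toBasis.ext fun i => ?_
    rcases eq_or_ne i k with rfl | hik
    · simp [A, e, LinearMap.transvection.apply, edgeMap_apply v (WithLp.toLp 2 c)]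
    · simp [A, e, LinearMap.transvection.apply, hik.symm, hik]
  rw [← hA, LinearMap.normDet_comp_of_finrank_eq _ _ rfl, LinearMap.normDet_eq_abs_det,
    LinearMap.transvection.det]
  simp [e]

theorem exists_edges {E : Type*} [AddCommGroup E] {σ : Set E} (hσ : σ.ncard = n + 1) {q : E} (hq : q ∈ σ) :
    ∃ v : Fin n → E, Function.Injective v ∧ (Set.range fun i => q + v i) = σ \ {q} := by
  have hfin : σ.Finite := Set.finite_of_ncard_ne_zero (by omega)
  have hc : (σ \ {q}).ncard = n := by
    rw [Set.ncard_sdiff_singleton_of_mem hq, hσ, Nat.add_sub_cancel]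
  have : Fintype ↥(σ \ {q}) := (hfin.subset Set.sdiff_subset).fintype
  have hcard : Fintype.card ↥(σ \ {q}) = n := by
    rw [← Nat.card_eq_fintype_card]
    exact hc
  let e := (Fintype.equivFinOfCardEq hcard).symm
  refine ⟨fun i => (e i : E) - q, fun i j hij => ?_, ?_⟩
  · exact e.injective (Subtype.ext (sub_left_injective hij))
  · simp only [add_sub_cancel]
    rw [show (fun i => (e i : E)) = Subtype.val ∘ e from rfl, Set.range_comp,
      e.surjective.range_eq, Set.image_univ, Subtype.range_coe]

theorem linearIndependent_edges {σ : Set E}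
    (hσ : AffineIndependent ℝ (Subtype.val : σ → E)) {q : E} (hq : q ∈ σ) {v : Fin n → E}
    (hv : Function.Injective v) (hr : (Set.range fun i => q + v i) = σ \ {q}) :
    LinearIndependent ℝ v := by
  have h := (affineIndependent_set_iff_linearIndependent_vsub ℝ hq).1 hσ
  have hmem : ∀ i, v i ∈ (fun p => p -ᵥ q) '' (σ \ {q}) := fun i =>
    ⟨q + v i, hr ▸ ⟨i, rfl⟩, by simp⟩
  exact h.comp (fun i => ⟨v i, hmem i⟩) fun i j hij => hv (congrArg Subtype.val hij)

theorem measure_convexHull_eq_of_edges [MeasurableSpace E] [BorelSpace E] {σ : Set E} {q : E}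
    (hq : q ∈ σ) {v : Fin n → E} (hr : (Set.range fun i => q + v i) = σ \ {q}) :
    μHE[n] (convexHull ℝ σ) =
      ENNReal.ofReal (edgeMap v).normDet * volume (cornerSimplex n) := by
  rw [← measure_convexHull_eq q v, hr, Set.insert_sdiff_singleton, Set.insert_eq_of_mem hq]

/-- A simplex has no larger volume than any simplex with vertices in the affine lattice
it generates. -/
theorem measure_convexHull_le_of_integral [MeasurableSpace E] [BorelSpace E] {σ τ : Set E}
    (hσ : σ.ncard = n + 1) (hτ : τ.ncard = n + 1)
    (hτi : AffineIndependent ℝ (Subtype.val : τ → E))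
    (h : ∀ x ∈ τ, ∀ q ∈ σ, x - q ∈ vectorSpan ℤ σ) :
    μHE[n] (convexHull ℝ σ) ≤ μHE[n] (convexHull ℝ τ) := by
  obtain ⟨q, hq⟩ : σ.Nonempty := Set.nonempty_of_ncard_ne_zero (by omega)
  obtain ⟨r, hr⟩ : τ.Nonempty := Set.nonempty_of_ncard_ne_zero (by omega)
  obtain ⟨v, hv, hvr⟩ := exists_edges hσ hq
  obtain ⟨w, hw, hwr⟩ := exists_edges hτ hr
  rw [measure_convexHull_eq_of_edges hq hvr, measure_convexHull_eq_of_edges hr hwr]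
  gcongr
  refine normDet_edgeMap_le (linearIndependent_edges hτi hr hw hwr) fun i => ?_
  have hspan : vectorSpan ℤ σ ≤ Submodule.span ℤ (Set.range v) := by
    rw [vectorSpan_eq_span_vsub_set_right_ne ℤ hq, ← hvr, ← Set.range_comp]
    refine Submodule.span_mono (Set.range_subset_range_iff_exists_comp.2 ⟨id, ?_⟩)
    ext i
    simp
  have hi : r + w i ∈ τ := (hwr.subset ⟨i, rfl⟩).1
  have := Submodule.sub_mem _ (hspan (h _ hi q hq)) (hspan (h _ hr q hq))
  simpa using this

/-- Comparing two simplices over a common facet, the volume is monotone in the height. -/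
theorem height_le_of_measure_convexHull_le [MeasurableSpace E] [BorelSpace E] {σ : Set E}
    {p q : E} (hne : σ.Nonempty) (hcard : (insert p σ).ncard = n + 1)
    (hi : AffineIndependent ℝ (Subtype.val : ↥(insert p σ) → E)) (f : E →ᵃ[ℝ] ℝ)
    (hf : ∀ x ∈ σ, f x = 0) (hp : 0 < f p) (hq : 0 ≤ f q)
    (hqs : q ∈ affineSpan ℝ (insert p σ))
    (hle : μHE[n] (convexHull ℝ (insert p σ)) ≤ μHE[n] (convexHull ℝ (insert q σ))) :
    f p ≤ f q := by
  obtain ⟨r, hr⟩ := hne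
  have hpr : p ≠ r := fun h => hp.ne' (h ▸ hf r hr)
  have hpσ : p ∉ σ := fun h => hp.ne' (hf p h)
  obtain ⟨v, hv, hvr⟩ := exists_edges hcard (Set.mem_insert_of_mem p hr)
  have hli := linearIndependent_edges hi (Set.mem_insert_of_mem p hr) hv hvr
  obtain ⟨k, hk⟩ : p ∈ Set.range fun i => r + v i := by
    rw [hvr]; exact ⟨Set.mem_insert _ _, hpr⟩
  simp only at hk
  have hvk : ∀ i, i ≠ k → r + v i ∈ σ := by
    intro i hik
    have h1 : r + v i ∈ insert p σ := (hvr.subset ⟨i, rfl⟩).1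
    refine h1.resolve_left fun h => hik (hv ?_)
    rw [← hk] at h
    exact add_left_cancel h
  have hspan : q - r ∈ Submodule.span ℝ (Set.range v) := by
    have h1 : q -ᵥ r ∈ vectorSpan ℝ (insert p σ) := by
      rw [← direction_affineSpan]
      exact AffineSubspace.vsub_mem_direction hqs
        (subset_affineSpan ℝ _ (Set.mem_insert_of_mem p hr))
    rw [vectorSpan_eq_span_vsub_set_right_ne ℝ (Set.mem_insert_of_mem p hr), ← hvr,
      ← Set.range_comp] at h1
    simpa [Function.comp_def] using h1
  obtain ⟨c, hc⟩ := (Submodule.mem_span_range_iff_exists_fun ℝ).1 hspan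
  have hfv : ∀ i, f.linear (v i) = f (r + v i) := by
    intro i
    have := f.map_vadd r (v i)
    simp only [vadd_eq_add, hf r hr, add_zero] at this
    rw [← this, add_comm]
  -- f vanishes on σ, so only the edge from r to p contributes to f q: the coordinate c k is the
  -- ratio of the heights.
  have hfq : f q = c k * f p := by
    have h1 : f.linear (q - r) = f q := by
      have := f.linearMap_vsub q r
      simpa [hf r hr] using this
    rw [← h1, ← hc, map_sum, Finset.sum_eq_single k]
    · rw [map_smul, hfv, hk, smul_eq_mul]
    · intro i _ hik
      rw [map_smul, hfv, hf _ (hvk i hik), smul_zero]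
    · simp
  have hwr : insert q σ = insert r (Set.range fun i => r + Function.update v k (q - r) i) := by
    ext x
    constructor
    · rintro (rfl | hx)
      · exact Or.inr ⟨k, by simp⟩
      · rcases eq_or_ne x r with rfl | hxr
        · exact Or.inl rfl
        · obtain ⟨i, rfl⟩ := hvr.superset ⟨Set.mem_insert_of_mem p hx, hxr⟩
          have hik : i ≠ k := by
            rintro rfl
            exact hpσ (hk ▸ hx)
          exact Or.inr ⟨i, by simp [hik]⟩
    · rintro (rfl | ⟨i, rfl⟩)
      · exact Or.inr hr
      · rcases eq_or_ne i k with rfl | hik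
        · exact Or.inl (by simp)
        · exact Or.inr (by simpa [hik] using hvk i hik)
  rw [measure_convexHull_eq_of_edges (Set.mem_insert_of_mem p hr) hvr, hwr,
    measure_convexHull_eq, ENNReal.mul_le_mul_iff_left volume_cornerSimplex_ne_zero
      volume_cornerSimplex_ne_top, ← hc, normDet_edgeMap_update,
    ENNReal.ofReal_le_ofReal_iff (by positivity [LinearMap.normDet_nonneg (edgeMap v)])] at hle
  have hpos : 0 < (edgeMap v).normDet :=
    (LinearMap.normDet_nonneg _).lt_of_ne' fun h0 =>
      LinearMap.normDet_eq_zero_iff_ker_ne_bot.1 h0 (ker_edgeMap hli)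
  have h1 : 1 ≤ |c k| := by
    by_contra! h
    nlinarith
  have hck : 0 ≤ c k := by
    rw [hfq] at hq
    exact nonneg_of_mul_nonneg_left hq hp
  rw [abs_of_nonneg hck] at h1
  rw [hfq]
  exact le_mul_of_one_le_left hp.le h1

end Volume

/-! ### Facet functionals and two-level sets -/

section FacetFunctional

variable {E : Type*} [AddCommGroup E] [Module ℝ E]

/-- An affine functional that is nonnegative on `V` and whose zeros in `V` span a facet of the
convex hull of `V`. -/
def IsFacetFunctional (V : Set E) (f : E →ᵃ[ℝ] ℝ) : Prop :=
  (∀ v ∈ V, 0 ≤ f v) ∧ (∃ v ∈ V, f v = 0) ∧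
    Module.finrank ℝ (vectorSpan ℝ {x ∈ V | f x = 0}) + 1 = Module.finrank ℝ (vectorSpan ℝ V)

/-- Every facet functional takes only one nonzero value on `V`. -/
def IsTwoLevel (V : Set E) : Prop :=
  ∀ f : E →ᵃ[ℝ] ℝ, IsFacetFunctional V f → ∀ p ∈ V, ∀ q ∈ V, f p ≠ 0 → f q ≠ 0 → f p = f q

/-- The points of the affine span of `V` at which the facet functionals with values in `{0, 1}`
on `V` are integral. -/
def integralPoints (V : Set E) : Set E :=
  {x | x ∈ affineSpan ℝ V ∧ ∀ f : E →ᵃ[ℝ] ℝ, IsFacetFunctional V f →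
    (∀ v ∈ V, f v = 0 ∨ f v = 1) → ∃ m : ℤ, f x = m}

theorem subset_integralPoints (V : Set E) : V ⊆ integralPoints V := by
  refine fun x hx => ⟨subset_affineSpan ℝ V hx, fun f _ h => ?_⟩
  rcases h x hx with h | h
  · exact ⟨0, by simpa using h⟩
  · exact ⟨1, by simpa using h⟩

theorem eq_zero_of_mem_affineSpan {f : E →ᵃ[ℝ] ℝ} {Z : Set E} (hf : ∀ z ∈ Z, f z = 0) {x : E}
    (hx : x ∈ affineSpan ℝ Z) : f x = 0 :=
  AffineMap.eqOn_affineSpan (f := f) (g := AffineMap.const ℝ E (0 : ℝ)) hf hx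

theorem vectorSpan_le_ker {f : E →ᵃ[ℝ] ℝ} {Z : Set E} (hf : ∀ z ∈ Z, f z = 0) :
    vectorSpan ℝ Z ≤ f.linear.ker := by
  rw [vectorSpan_def, Submodule.span_le]
  rintro _ ⟨x, hx, y, hy, rfl⟩
  rw [SetLike.mem_coe, LinearMap.mem_ker, AffineMap.linearMap_vsub, hf x hx, hf y hy, vsub_self]

theorem finrank_vectorSpan_lt [FiniteDimensional ℝ E] {Z V : Set E} (hZV : Z ⊆ V)
    {f : E →ᵃ[ℝ] ℝ} (hf : ∀ z ∈ Z, f z = 0) (hne : Z.Nonempty) {v : E} (hv : v ∈ V)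
    (hfv : f v ≠ 0) :
    Module.finrank ℝ (vectorSpan ℝ Z) < Module.finrank ℝ (vectorSpan ℝ V) := by
  obtain ⟨z, hz⟩ := hne
  refine Submodule.finrank_lt_finrank_of_lt ((vectorSpan_mono ℝ hZV).lt_of_not_ge fun h => ?_)
  have h1 := vectorSpan_le_ker hf (h (vsub_mem_vectorSpan ℝ hv (hZV hz)))
  rw [LinearMap.mem_ker, AffineMap.linearMap_vsub, hf z hz] at h1
  exact hfv (by simpa using h1)

theorem IsFacetFunctional.exists_ne_zero {V : Set E} {f : E →ᵃ[ℝ] ℝ}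
    (hf : IsFacetFunctional V f) : ∃ v ∈ V, f v ≠ 0 := by
  by_contra! h
  have h1 := hf.2.2
  rw [Set.sep_eq_self_iff_mem_true.2 h] at h1
  omega

/-- The zeros of f in V span a subspace of `vectorSpan ℝ V ⊓ f.linear.ker`, which is proper in
`vectorSpan ℝ V`; codimension one forces equality. -/
theorem IsFacetFunctional.mem_affineSpan [FiniteDimensional ℝ E] {V : Set E} {f : E →ᵃ[ℝ] ℝ}
    (hf : IsFacetFunctional V f) {x : E} (hx : x ∈ affineSpan ℝ V) (hfx : f x = 0) :
    x ∈ affineSpan ℝ {x ∈ V | f x = 0} := by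
  obtain ⟨z, hz, hfz⟩ := hf.2.1
  obtain ⟨v, hv, hfv⟩ := hf.exists_ne_zero
  have hle : vectorSpan ℝ {x ∈ V | f x = 0} ≤ vectorSpan ℝ V ⊓ f.linear.ker :=
    le_inf (vectorSpan_mono ℝ fun x hx => hx.1) (vectorSpan_le_ker fun x hx => hx.2)
  have hlt : vectorSpan ℝ V ⊓ f.linear.ker < vectorSpan ℝ V := by
    refine inf_le_left.lt_of_not_ge fun h => ?_
    have h1 := (h (vsub_mem_vectorSpan ℝ hv hz)).2
    rw [SetLike.mem_coe, LinearMap.mem_ker, AffineMap.linearMap_vsub, hfz] at h1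
    exact hfv (by simpa using h1)
  have heq := Submodule.eq_of_le_of_finrank_le hle (by
    have := Submodule.finrank_lt_finrank_of_lt hlt
    have := hf.2.2
    omega)
  have hxz : x -ᵥ z ∈ vectorSpan ℝ {x ∈ V | f x = 0} := by
    rw [heq]
    refine ⟨?_, ?_⟩
    · rw [← direction_affineSpan]
      exact AffineSubspace.vsub_mem_direction hx (subset_affineSpan ℝ _ hz)
    · rw [SetLike.mem_coe, LinearMap.mem_ker, AffineMap.linearMap_vsub, hfz, hfx]
      simp
  have := AffineSubspace.vadd_mem_of_mem_direction
    (by rwa [direction_affineSpan]) (subset_affineSpan ℝ {x ∈ V | f x = 0} ⟨hz, hfz⟩)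
  rwa [vsub_vadd] at this

/-- A supporting functional can be rotated about its zeros, keeping its value at `p`. -/
theorem exists_isFacetFunctional_of_supporting [FiniteDimensional ℝ E] {V : Set E}
    (hV : V.Finite) {p : E} (hp : p ∈ V) (k : ℕ) (f : E →ᵃ[ℝ] ℝ) (hf : ∀ v ∈ V, 0 ≤ f v)
    (hz : ∃ v ∈ V, f v = 0) (hfp : 0 < f p)
    (hk : Module.finrank ℝ (vectorSpan ℝ V) ≤
      Module.finrank ℝ (vectorSpan ℝ {x ∈ V | f x = 0}) + 1 + k) :
    ∃ g : E →ᵃ[ℝ] ℝ, IsFacetFunctional V g ∧ 0 < g p := by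
  induction k generalizing f with
  | zero =>
    refine ⟨f, ⟨hf, hz, ?_⟩, hfp⟩
    obtain ⟨z, hz, hfz⟩ := hz
    have := finrank_vectorSpan_lt (V := V) (Z := {x ∈ V | f x = 0}) (f := f) (fun x hx => hx.1)
      (fun x hx => hx.2) ⟨z, hz, hfz⟩ hp hfp.ne'
    omega
  | succ k ih =>
    by_cases hk' : Module.finrank ℝ (vectorSpan ℝ V) ≤
      Module.finrank ℝ (vectorSpan ℝ {x ∈ V | f x = 0}) + 1
    · exact ih f hf hz hfp (by omega)
    obtain ⟨z, hz, hfz⟩ := hz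
    set Z := {x ∈ V | f x = 0} with hZ
    -- Z has codimension at least two here, and adding p raises the dimension by at most one.
    obtain ⟨v, hv, hvW⟩ : ∃ v ∈ V, v - z ∉ vectorSpan ℝ (insert p Z) := by
      by_contra! h
      have hle : vectorSpan ℝ V ≤ vectorSpan ℝ (insert p Z) := by
        rw [vectorSpan_eq_span_vsub_set_right ℝ hz, Submodule.span_le]
        rintro _ ⟨v, hv, rfl⟩
        exact h v hv
      have := Submodule.finrank_mono hle
      have := finrank_vectorSpan_insert_le_set ℝ Z p
      omega
    obtain ⟨φ, hφv, hφW⟩ : ∃ φ : E →ₗ[ℝ] ℝ, φ (v - z) < 0 ∧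
        vectorSpan ℝ (insert p Z) ≤ φ.ker := by
      obtain ⟨φ, hφ, hW⟩ := Submodule.exists_le_ker_of_notMem hvW
      rcases lt_or_gt_of_ne hφ with h | h
      · exact ⟨φ, h, hW⟩
      · refine ⟨-φ, by simpa using h, fun x hx => ?_⟩
        have := hW hx
        simp_all
    let g : E →ᵃ[ℝ] ℝ := φ.toAffineMap - AffineMap.const ℝ E (φ z)
    have hg : ∀ x, g x = φ (x - z) := fun x => by simp [g]
    have hg0 : ∀ x ∈ insert p Z, g x = 0 := fun x hx => by
      rw [hg]
      exact hφW (vsub_mem_vectorSpan ℝ hx (Set.mem_insert_of_mem p ⟨hz, hfz⟩))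
    -- Ratio test: the minimum is the largest t for which f + t g stays nonnegative on V, and w
    -- becomes a new zero. Since g vanishes at p and on Z, the value at p and the old zeros survive.
    obtain ⟨w, ⟨hw, hgw⟩, hmin⟩ := Set.exists_min_image {x ∈ V | g x < 0}
      (fun x => f x / (-g x)) (hV.subset fun x hx => hx.1) ⟨v, hv, by rwa [hg]⟩
    have ht : 0 ≤ f w / (-g w) := div_nonneg (hf w hw) (by linarith)
    let h : E →ᵃ[ℝ] ℝ := f + (f w / (-g w)) • g
    have hh : ∀ x, h x = f x + f w / (-g w) * g x := fun x => by simp [h]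
    have hh0 : ∀ x ∈ insert p Z, h x = f x := fun x hx => by rw [hh, hg0 x hx, mul_zero, add_zero]
    have hhw : h w = 0 := by
      rw [hh, div_mul_eq_mul_div, div_neg, mul_div_cancel_right₀ _ hgw.ne, add_neg_cancel]
    have hlt : Module.finrank ℝ (vectorSpan ℝ Z) <
        Module.finrank ℝ (vectorSpan ℝ {x ∈ V | h x = 0}) := by
      refine finrank_vectorSpan_lt (f := g) ?_ (fun x hx => hg0 x (Set.mem_insert_of_mem p hx))
        ⟨z, hz, hfz⟩ (v := w) ⟨hw, hhw⟩ hgw.ne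
      exact fun x hx => ⟨hx.1, by rw [hh0 x (Set.mem_insert_of_mem p hx), hx.2]⟩
    refine ih h (fun x hx => ?_) ⟨w, hw, hhw⟩ ?_ (by omega)
    · rw [hh]
      rcases le_or_gt 0 (g x) with h0 | h0
      · exact add_nonneg (hf x hx) (mul_nonneg ht h0)
      · have := hmin x ⟨hx, h0⟩
        rw [le_div_iff₀ (by linarith)] at this
        linarith
    · rwa [hh0 p (Set.mem_insert _ _)]

/-- Some facet avoids a given point, unless that point is alone. -/
theorem exists_isFacetFunctional_pos [FiniteDimensional ℝ E] {V : Set E} (hV : V.Finite)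
    {p q : E} (hp : p ∈ V) (hq : q ∈ V) (hpq : p ≠ q) :
    ∃ f : E →ᵃ[ℝ] ℝ, IsFacetFunctional V f ∧ 0 < f p := by
  obtain ⟨φ, hφ⟩ : ∃ φ : E →ₗ[ℝ] ℝ, φ q < φ p := by
    obtain ⟨φ, hφ⟩ := Module.Projective.exists_dual_eq_one ℝ (sub_ne_zero.2 hpq)
    refine ⟨φ, ?_⟩
    rw [map_sub] at hφ
    linarith
  obtain ⟨z, hz, hmin⟩ := Set.exists_min_image V φ hV ⟨p, hp⟩
  refine exists_isFacetFunctional_of_supporting hV hp (Module.finrank ℝ (vectorSpan ℝ V))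
    (φ.toAffineMap - AffineMap.const ℝ E (φ z)) (fun v hv => ?_) ⟨z, hz, by simp⟩ ?_ (by omega)
  · simpa using hmin v hv
  · simpa using (hmin q hq).trans_lt hφ

/-- Every facet of a facet is cut out by a facet functional of the whole. -/
theorem IsFacetFunctional.exists_extension [FiniteDimensional ℝ E] {V : Set E} (hV : V.Finite)
    {f g : E →ᵃ[ℝ] ℝ} (hf : IsFacetFunctional V f)
    (hg : IsFacetFunctional {x ∈ V | f x = 0} g) :
    ∃ h : E →ᵃ[ℝ] ℝ, IsFacetFunctional V h ∧ ∀ x, f x = 0 → h x = g x := by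
  obtain ⟨v, hv, hfv⟩ := hf.exists_ne_zero
  -- The maximum is the least multiple of f, possibly negative, whose addition makes g nonnegative
  -- on all of V; w is then a zero off the facet.
  obtain ⟨w, ⟨hw, hfw⟩, hmax⟩ := Set.exists_max_image {x ∈ V | f x ≠ 0}
    (fun x => -g x / f x) (hV.subset fun x hx => hx.1) ⟨v, hv, hfv⟩
  let h : E →ᵃ[ℝ] ℝ := g + (-g w / f w) • f
  have hh : ∀ x, h x = g x + -g w / f w * f x := fun x => by simp [h]
  have hh0 : ∀ x, f x = 0 → h x = g x := fun x hx => by rw [hh, hx, mul_zero, add_zero]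
  have hhw : h w = 0 := by
    rw [hh, div_mul_cancel₀ _ hfw, add_neg_cancel]
  refine ⟨h, ⟨fun x hx => ?_, ⟨w, hw, hhw⟩, ?_⟩, hh0⟩
  · by_cases hfx : f x = 0
    · rw [hh0 x hfx]
      exact hg.1 x ⟨hx, hfx⟩
    · have := hmax x ⟨hx, hfx⟩
      rw [div_le_iff₀ ((hf.1 x hx).lt_of_ne' hfx)] at this
      rw [hh]
      linarith
  · obtain ⟨z, ⟨hz, hfz⟩, hgz⟩ := hg.2.1
    obtain ⟨y, ⟨hy, hfy⟩, hgy⟩ := hg.exists_ne_zero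
    -- The zeros of h span strictly more than the codimension-two face and strictly less than V,
    -- hence have codimension one.
    have h1 : Module.finrank ℝ (vectorSpan ℝ {x ∈ {x ∈ V | f x = 0} | g x = 0}) <
        Module.finrank ℝ (vectorSpan ℝ {x ∈ V | h x = 0}) :=
      finrank_vectorSpan_lt (f := f) (fun x hx => ⟨hx.1.1, by rw [hh0 x hx.1.2, hx.2]⟩)
        (fun x hx => hx.1.2) ⟨z, ⟨hz, hfz⟩, hgz⟩ (v := w) ⟨hw, hhw⟩ hfw
    have h2 : Module.finrank ℝ (vectorSpan ℝ {x ∈ V | h x = 0}) <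
        Module.finrank ℝ (vectorSpan ℝ V) :=
      finrank_vectorSpan_lt (f := h) (fun x hx => hx.1) (fun x hx => hx.2) ⟨w, hw, hhw⟩ hy
        (by rwa [hh0 y hfy])
    have h3 := hf.2.2
    have h4 := hg.2.2
    omega

theorem IsTwoLevel.facet [FiniteDimensional ℝ E] {V : Set E} (hV : V.Finite) (h2 : IsTwoLevel V)
    {f : E →ᵃ[ℝ] ℝ} (hf : IsFacetFunctional V f) : IsTwoLevel {x ∈ V | f x = 0} := by
  intro g hg p hp q hq hgp hgq
  obtain ⟨h, hh, hhg⟩ := hf.exists_extension hV hg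
  rw [← hhg p hp.2] at hgp ⊢
  rw [← hhg q hq.2] at hgq ⊢
  exact h2 h hh p hp.1 q hq.1 hgp hgq

/-- A 0/1 functional on the facet extends to V. By two-levelness the extension has the same nonzero
value off the facet as on it, namely 1, so integrality at x applies to it. -/
theorem IsTwoLevel.mem_integralPoints_facet [FiniteDimensional ℝ E] {V : Set E} (hV : V.Finite)
    (h2 : IsTwoLevel V) {f : E →ᵃ[ℝ] ℝ} (hf : IsFacetFunctional V f) {x : E}
    (hx : x ∈ integralPoints V) (hfx : f x = 0) : x ∈ integralPoints {x ∈ V | f x = 0} := by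
  refine ⟨hf.mem_affineSpan hx.1 hfx, fun g hg hg01 => ?_⟩
  obtain ⟨h, hh, hhg⟩ := hf.exists_extension hV hg
  rw [← hhg x hfx]
  refine hx.2 h hh fun v hv => or_iff_not_imp_left.2 fun hhv => ?_
  obtain ⟨y, hy, hgy⟩ := hg.exists_ne_zero
  rw [h2 h hh v hv y hy.1 hhv (by rwa [hhg y hy.2]), hhg y hy.2]
  exact (hg01 y hy).resolve_left hgy

/-- A facet functional of a two-level set can be normalized. -/
theorem IsTwoLevel.exists_normalized {V : Set E} (h2 : IsTwoLevel V)
    {f : E →ᵃ[ℝ] ℝ} (hf : IsFacetFunctional V f) :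
    ∃ g : E →ᵃ[ℝ] ℝ, IsFacetFunctional V g ∧ (∀ x, g x = 0 ↔ f x = 0) ∧
      ∀ v ∈ V, g v = 0 ∨ g v = 1 := by
  obtain ⟨y, hy, hfy⟩ := hf.exists_ne_zero
  have hg : ∀ x, ((f y)⁻¹ • f) x = (f y)⁻¹ * f x := fun x => by simp
  have hg0 : ∀ x, ((f y)⁻¹ • f) x = 0 ↔ f x = 0 := fun x => by simp [hfy]
  refine ⟨(f y)⁻¹ • f, ⟨fun v hv => ?_, ?_, ?_⟩, hg0, fun v hv => ?_⟩
  · rw [hg]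
    exact mul_nonneg (inv_nonneg.2 (hf.1 y hy)) (hf.1 v hv)
  · simpa only [hg0] using hf.2.1
  · rw [show {x ∈ V | ((f y)⁻¹ • f) x = 0} = {x ∈ V | f x = 0} from
      Set.ext fun x => and_congr_right fun _ => hg0 x]
    exact hf.2.2
  · by_cases h0 : f v = 0
    · exact Or.inl ((hg0 v).2 h0)
    · rw [hg, h2 f hf v hv y hy h0 hfy, inv_mul_cancel₀ hfy]
      exact Or.inr rfl

end FacetFunctional

/-! ### Full-dimensional simplices and the affine lattices they generate -/

section Simplex

variable {E : Type*} [AddCommGroup E] [Module ℝ E]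

theorem affineIndependent_iff_finrank {σ : Set E} {m : ℕ} (hσ : σ.ncard = m + 1) :
    AffineIndependent ℝ (Subtype.val : σ → E) ↔ Module.finrank ℝ (vectorSpan ℝ σ) = m := by
  have : Fintype σ := (Set.finite_of_ncard_ne_zero (by omega : σ.ncard ≠ 0)).fintype
  rw [affineIndependent_iff_finrank_vectorSpan_eq ℝ (Subtype.val : σ → E) (n := m)
    (by rw [← Nat.card_eq_fintype_card]; exact hσ), Subtype.range_coe]

theorem affineIndependent_iff_le_finrank {σ : Set E} {m : ℕ} (hσ : σ.ncard = m + 1) :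
    AffineIndependent ℝ (Subtype.val : σ → E) ↔ m ≤ Module.finrank ℝ (vectorSpan ℝ σ) := by
  have : Fintype σ := (Set.finite_of_ncard_ne_zero (by omega : σ.ncard ≠ 0)).fintype
  rw [affineIndependent_iff_le_finrank_vectorSpan ℝ (Subtype.val : σ → E) (n := m)
    (by rw [← Nat.card_eq_fintype_card]; exact hσ), Subtype.range_coe]

/-- `σ` is the vertex set of a full-dimensional simplex with vertices in `V`. -/
def IsFullSimplex (V σ : Set E) : Prop :=
  σ ⊆ V ∧ σ.ncard = Module.finrank ℝ (vectorSpan ℝ V) + 1 ∧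
    AffineIndependent ℝ (Subtype.val : σ → E)

theorem IsFullSimplex.nonempty {V σ : Set E} (h : IsFullSimplex V σ) : σ.Nonempty :=
  Set.nonempty_of_ncard_ne_zero (by rw [h.2.1]; omega)

theorem IsFullSimplex.affineSpan_eq [FiniteDimensional ℝ E] {V σ : Set E}
    (h : IsFullSimplex V σ) : affineSpan ℝ σ = affineSpan ℝ V := by
  obtain ⟨q, hq⟩ := h.nonempty
  refine AffineSubspace.ext_of_direction_eq ?_
    ⟨q, subset_affineSpan ℝ σ hq, subset_affineSpan ℝ V (h.1 hq)⟩
  rw [direction_affineSpan, direction_affineSpan]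
  exact Submodule.eq_of_le_of_finrank_eq (vectorSpan_mono ℝ h.1)
    ((affineIndependent_iff_finrank h.2.1).1 h.2.2)

theorem isFullSimplex_self {V : Set E} (hV : V.Finite) (hne : V.Nonempty)
    (hi : AffineIndependent ℝ (Subtype.val : V → E)) : IsFullSimplex V V := by
  obtain ⟨m, hm⟩ := Nat.exists_eq_succ_of_ne_zero (Set.ncard_ne_zero_of_mem hne.some_mem hV)
  refine ⟨subset_rfl, ?_, hi⟩
  rw [(affineIndependent_iff_finrank hm).1 hi, hm]

theorem IsFullSimplex.insert_of_facet [FiniteDimensional ℝ E] {V σ : Set E} {f : E →ᵃ[ℝ] ℝ}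
    (hf : IsFacetFunctional V f) (hσ : IsFullSimplex {x ∈ V | f x = 0} σ) {p : E} (hp : p ∈ V)
    (hfp : f p ≠ 0) : IsFullSimplex V (insert p σ) := by
  have hpσ : p ∉ σ := fun h => hfp (hσ.1 h).2
  have hfin : σ.Finite := Set.finite_of_ncard_ne_zero (by rw [hσ.2.1]; omega)
  have hc : (insert p σ).ncard = Module.finrank ℝ (vectorSpan ℝ V) + 1 := by
    rw [Set.ncard_insert_of_notMem hpσ hfin, hσ.2.1, hf.2.2]
  refine ⟨Set.insert_subset hp fun x hx => (hσ.1 hx).1, hc, ?_⟩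
  rw [affineIndependent_iff_le_finrank hc, ← hf.2.2,
    ← (affineIndependent_iff_finrank hσ.2.1).1 hσ.2.2]
  exact finrank_vectorSpan_lt (Set.subset_insert p σ) (fun x hx => (hσ.1 hx).2) hσ.nonempty
    (Set.mem_insert p σ) hfp

theorem exists_barycentric {V : Set E} (hi : AffineIndependent ℝ (Subtype.val : V → E)) {v : E}
    (hv : v ∈ V) : ∃ f : E →ᵃ[ℝ] ℝ, f v = 1 ∧ ∀ u ∈ V, u ≠ v → f u = 0 := by
  obtain ⟨t, hVt, hti, htop⟩ := exists_subset_affineIndependent_affineSpan_eq_top hi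
  let b : AffineBasis t ℝ E := ⟨Subtype.val, hti, by rwa [Subtype.range_coe]⟩
  refine ⟨b.coord ⟨v, hVt hv⟩, b.coord_apply_eq ⟨v, hVt hv⟩, fun u hu huv => ?_⟩
  exact b.coord_apply_ne (i := ⟨v, hVt hv⟩) (j := ⟨u, hVt hu⟩) fun h =>
    huv (congrArg Subtype.val h).symm

/-- Base case of the generation argument: the barycentric coordinates of a simplex are 0/1 facet
functionals, hence integral at x. The vertex q needs no coordinate, its edge being zero. -/
theorem vsub_mem_vectorSpan_of_affineIndependent [FiniteDimensional ℝ E] {V : Set E}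
    (hV : V.Finite) (hi : AffineIndependent ℝ (Subtype.val : V → E)) {x q : E}
    (hx : x ∈ integralPoints V) (hq : q ∈ V) : x - q ∈ vectorSpan ℤ V := by
  have : Fintype V := hV.fintype
  have hx' := hx.1
  rw [← Subtype.range_coe (s := V)] at hx'
  obtain ⟨w, hw, hxw⟩ := eq_affineCombination_of_mem_affineSpan_of_fintype hx'
  rw [Finset.affineCombination_eq_linear_combination _ _ _ hw] at hxw
  have hxq : x - q = ∑ v : V, w v • ((v : E) - q) := by
    simp only [smul_sub, Finset.sum_sub_distrib, ← Finset.sum_smul, hw, one_smul, ← hxw]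
  rw [hxq]
  refine Submodule.sum_mem _ fun v _ => ?_
  rcases eq_or_ne (v : E) q with hvq | hvq
  · simp [hvq]
  obtain ⟨f, hfv, hf0⟩ := exists_barycentric hi v.2
  have hfq : f q = 0 := hf0 q hq hvq.symm
  have h01 : ∀ u ∈ V, f u = 0 ∨ f u = 1 := fun u hu => by
    by_cases h : u = v
    · exact Or.inr (h ▸ hfv)
    · exact Or.inl (hf0 u hu h)
  have hZ : {u ∈ V | f u = 0} = V \ {(v : E)} := by
    ext u
    refine and_congr_right fun hu => ⟨fun h huv => ?_, fun h => hf0 u hu h⟩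
    rw [Set.mem_singleton_iff.1 huv, hfv] at h
    exact one_ne_zero h
  have hfacet : IsFacetFunctional V f := by
    refine ⟨fun u hu => ?_, ⟨q, hq, hfq⟩, ?_⟩
    · rcases h01 u hu with h | h <;> rw [h]
      exact zero_le_one
    · have hqZ : q ∈ V \ {(v : E)} := ⟨hq, hvq.symm⟩
      have h1 := (isFullSimplex_self hV ⟨q, hq⟩ hi).2.1
      have h2 := (isFullSimplex_self (hV.subset Set.sdiff_subset) ⟨q, hqZ⟩
        (hi.mono Set.sdiff_subset)).2.1
      have h3 := Set.ncard_sdiff_singleton_add_one v.2 hV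
      rw [hZ]
      omega
  obtain ⟨m, hm⟩ := hx.2 f hfacet h01
  have hfx : f x = w v := by
    have h1 : f.linear (x - q) = f x := by
      have := f.linearMap_vsub x q
      simpa [hfq] using this
    rw [← h1, hxq, map_sum, Finset.sum_eq_single v]
    · have := f.linearMap_vsub (v : E) q
      rw [vsub_eq_sub] at this
      simp [map_smul, this, hfv, hfq]
    · intro u _ huv
      have := f.linearMap_vsub (u : E) q
      rw [vsub_eq_sub] at this
      simp [map_smul, this, hf0 u u.2 fun h => huv (Subtype.ext h), hfq]
    · simp
  rw [← hfx, hm, Int.cast_smul_eq_zsmul]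
  exact Submodule.smul_mem _ _ (vsub_mem_vectorSpan ℤ v.2 hq)

/-- Inductive step of the generation argument: an integer multiple of the edge p - r moves x into
the hyperplane of the facet, where the hypothesis on σ applies. -/
theorem vsub_mem_vectorSpan_insert [FiniteDimensional ℝ E] {V : Set E} (hV : V.Finite)
    (h2 : IsTwoLevel V) {f : E →ᵃ[ℝ] ℝ} (hf : IsFacetFunctional V f) {p : E} (hp : p ∈ V)
    (hfp : f p ≠ 0) {σ : Set E} (hne : σ.Nonempty) (hσV : σ ⊆ {x ∈ V | f x = 0})
    (h : ∀ x ∈ integralPoints {x ∈ V | f x = 0}, ∀ q ∈ σ, x - q ∈ vectorSpan ℤ σ)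
    {x q : E} (hx : x ∈ integralPoints V) (hq : q ∈ insert p σ) :
    x - q ∈ vectorSpan ℤ (insert p σ) := by
  obtain ⟨r, hr⟩ := hne
  have hrV := hσV hr
  suffices hxr : x - r ∈ vectorSpan ℤ (insert p σ) by
    have := Submodule.add_mem _ hxr
      (vsub_mem_vectorSpan ℤ (Set.mem_insert_of_mem p hr) hq)
    simpa using this
  obtain ⟨g, hg, hgf, hg01⟩ := h2.exists_normalized hf
  obtain ⟨m, hm⟩ := hx.2 g hg hg01
  have hgp : g p = 1 := (hg01 p hp).resolve_left fun h0 => hfp ((hgf p).1 h0)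
  have hmap : ∀ k : E →ᵃ[ℝ] ℝ, k (x - m • (p - r)) = k x - m * (k p - k r) := by
    intro k
    have h1 := k.map_vadd x (-(m • (p - r)))
    have h3 := k.linearMap_vsub p r
    rw [vsub_eq_sub, vsub_eq_sub] at h3
    rw [vadd_eq_add, map_neg, map_zsmul, h3, vadd_eq_add, zsmul_eq_mul] at h1
    rw [sub_eq_neg_add, h1]
    ring
  -- Integral points, unlike V itself, are stable under this translation, since p and r are integral
  -- too.
  have hy : x - m • (p - r) ∈ integralPoints V := by
    refine ⟨?_, fun k hk hk01 => ?_⟩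
    · have hd : (-m : ℝ) • (p -ᵥ r) ∈ (affineSpan ℝ V).direction := by
        rw [direction_affineSpan]
        exact Submodule.smul_mem _ _ (vsub_mem_vectorSpan ℝ hp hrV.1)
      have := AffineSubspace.vadd_mem_of_mem_direction hd hx.1
      rwa [vadd_eq_add, neg_smul, Int.cast_smul_eq_zsmul, ← sub_eq_neg_add] at this
    · obtain ⟨a, ha⟩ := hx.2 k hk hk01
      obtain ⟨b, hb⟩ := (subset_integralPoints V hp).2 k hk hk01
      obtain ⟨c, hc⟩ := (subset_integralPoints V hrV.1).2 k hk hk01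
      exact ⟨a - m * (b - c), by rw [hmap, ha, hb, hc]; push_cast; ring⟩
  have hfy : f (x - m • (p - r)) = 0 := by
    rw [← hgf, hmap, hm, hgp, (hgf r).2 hrV.2]
    ring
  have h1 := vectorSpan_mono ℤ (Set.subset_insert p σ)
    (h _ (h2.mem_integralPoints_facet hV hf hy hfy) r hr)
  have h3 : m • (p - r) ∈ vectorSpan ℤ (insert p σ) :=
    Submodule.smul_mem _ _ (vsub_mem_vectorSpan ℤ (Set.mem_insert p σ)
      (Set.mem_insert_of_mem p hr))
  have := Submodule.add_mem _ h1 h3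
  rwa [show x - m • (p - r) - r + m • (p - r) = x - r by abel] at this

/-- In a convex combination where f vanishes, every term w y * f y is nonnegative and they sum to
zero, so the weight sits on zeros of f. -/
theorem setOf_mem_convexHull_eq_zero {V : Set E} (hV : V.Finite) {f : E →ᵃ[ℝ] ℝ}
    (hf : ∀ v ∈ V, 0 ≤ f v) :
    {x ∈ convexHull ℝ V | f x = 0} = convexHull ℝ {x ∈ V | f x = 0} := by
  refine Set.Subset.antisymm ?_ fun x hx => ⟨convexHull_mono (fun x hx => hx.1) hx,
    eq_zero_of_mem_affineSpan (fun z hz => hz.2) (convexHull_subset_affineSpan _ hx)⟩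
  rintro x ⟨hx, hfx⟩
  rw [← hV.coe_toFinset, Finset.mem_convexHull'] at hx
  obtain ⟨w, hw0, hw1, rfl⟩ := hx
  have hlin : ∀ y, f y = f.linear y + f 0 := fun y => by
    have := f.map_vadd 0 y
    simpa using this
  have hsum : ∑ y ∈ hV.toFinset, w y * f y = 0 := by
    calc ∑ y ∈ hV.toFinset, w y * f y
        = ∑ y ∈ hV.toFinset, (w y * f.linear y + w y * f 0) :=
          Finset.sum_congr rfl fun y _ => by rw [hlin y, mul_add]
      _ = f.linear (∑ y ∈ hV.toFinset, w y • y) + f 0 := by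
          rw [Finset.sum_add_distrib, ← Finset.sum_mul, hw1, one_mul, map_sum]
          simp only [map_smul, smul_eq_mul]
      _ = 0 := by rw [← hlin, hfx]
  have hzero := (Finset.sum_eq_zero_iff_of_nonneg fun y hy =>
    mul_nonneg (hw0 y hy) (hf y (hV.mem_toFinset.1 hy))).1 hsum
  classical
  rw [← Finset.sum_filter_of_ne (p := fun y => w y ≠ 0)
    fun y _ h h0 => h (by rw [h0, zero_smul])]
  refine (convex_convexHull ℝ {x ∈ V | f x = 0}).sum_mem
    (fun y hy => hw0 y (Finset.mem_of_mem_filter y hy)) ?_ fun y hy => subset_convexHull ℝ _ ?_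
  · rw [Finset.sum_filter_ne_zero, hw1]
  · rw [Finset.mem_filter] at hy
    exact ⟨hV.mem_toFinset.1 hy.1, (mul_eq_zero.1 (hzero y hy.1)).resolve_left hy.2⟩

end Simplex

/-! ### Pulling triangulations in terms of facet functionals -/

section Pulling

variable {d : ℕ}

theorem dim_convexHull (V : Set (EuclideanSpace ℝ (Fin d))) :
    dim (convexHull ℝ V) = Module.finrank ℝ (vectorSpan ℝ V) := by
  rw [dim, ← direction_affineSpan, affineSpan_convexHull, direction_affineSpan]

theorem IsFacet.exists_functional {V F : Set (EuclideanSpace ℝ (Fin d))} (hV : V.Finite)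
    (hF : IsFacet (convexHull ℝ V) F) :
    ∃ f : EuclideanSpace ℝ (Fin d) →ᵃ[ℝ] ℝ, IsFacetFunctional V f ∧
      F = {x ∈ convexHull ℝ V | f x = 0} := by
  obtain ⟨hne, hexp, hdim⟩ := hF
  obtain ⟨φ, hφ⟩ := hexp hne
  obtain ⟨z, hz⟩ := hne
  have hz' := hz
  rw [hφ] at hz'
  let f : EuclideanSpace ℝ (Fin d) →ᵃ[ℝ] ℝ :=
    AffineMap.const ℝ _ (φ z) - φ.toLinearMap.toAffineMap
  have hf : ∀ x, f x = φ z - φ x := fun x => by simp [f]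
  have hnonneg : ∀ v ∈ V, 0 ≤ f v := fun v hv => by
    rw [hf]
    exact sub_nonneg.2 (hz'.2 v (subset_convexHull ℝ V hv))
  have hFeq : F = {x ∈ convexHull ℝ V | f x = 0} := by
    rw [hφ]
    ext x
    refine and_congr_right fun hx => ?_
    rw [hf, sub_eq_zero]
    exact ⟨fun h => le_antisymm (h z hz'.1) (hz'.2 x hx), fun h y hy => h ▸ hz'.2 y hy⟩
  have hFconv := hFeq
  rw [setOf_mem_convexHull_eq_zero hV hnonneg] at hFconv
  refine ⟨f, ⟨hnonneg, ?_, ?_⟩, hFeq⟩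
  · rw [hFconv] at hz
    exact convexHull_nonempty_iff.1 ⟨z, hz⟩
  · rwa [hFconv, dim_convexHull, dim_convexHull] at hdim

theorem IsFacetFunctional.isFacet {V : Set (EuclideanSpace ℝ (Fin d))} (hV : V.Finite)
    {f : EuclideanSpace ℝ (Fin d) →ᵃ[ℝ] ℝ} (hf : IsFacetFunctional V f) :
    IsFacet (convexHull ℝ V) {x ∈ convexHull ℝ V | f x = 0} := by
  obtain ⟨z, hz, hfz⟩ := hf.2.1
  have hzV := subset_convexHull ℝ V hz
  have hpos : ∀ x ∈ convexHull ℝ V, 0 ≤ f x := fun x hx =>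
    convexHull_min (t := f ⁻¹' Set.Ici 0) hf.1 ((convex_Ici 0).affine_preimage f) hx
  refine ⟨⟨z, hzV, hfz⟩, fun _ => ⟨(-f.linear).toContinuousLinearMap, ?_⟩, ?_⟩
  · ext x
    refine and_congr_right fun hx => ?_
    have key : ∀ y, (-f.linear).toContinuousLinearMap y ≤ (-f.linear).toContinuousLinearMap x ↔
        f x ≤ f y := by
      intro y
      have h1 := f.linearMap_vsub x y
      rw [vsub_eq_sub, vsub_eq_sub, map_sub] at h1
      simp only [LinearMap.coe_toContinuousLinearMap', LinearMap.neg_apply, neg_le_neg_iff]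
      constructor <;> intro h <;> linarith
    simp only [key]
    exact ⟨fun h y hy => h ▸ hpos y hy,
      fun h => le_antisymm (hfz ▸ h z hzV) (hpos x hx)⟩
  · rw [setOf_mem_convexHull_eq_zero hV hf.1, dim_convexHull, dim_convexHull]
    exact hf.2.2

open Classical in
theorem setOf_mem_filter_eq {p : EuclideanSpace ℝ (Fin d)}
    {l : List (EuclideanSpace ℝ (Fin d))} {f : EuclideanSpace ℝ (Fin d) →ᵃ[ℝ] ℝ}
    (hfp : 0 < f p) :
    {x | x ∈ l.filter (fun x => f x = 0)} = {x ∈ {x | x ∈ p :: l} | f x = 0} := by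
  ext x
  simp only [Set.mem_ofPred_eq, List.mem_cons, List.mem_filter, decide_eq_true_eq]
  constructor
  · exact fun h => ⟨Or.inr h.1, h.2⟩
  · rintro ⟨rfl | hx, h0⟩
    · exact absurd h0 hfp.ne'
    · exact ⟨hx, h0⟩

open Classical in
-- Rewriting the recursion with functionals keeps every polytope in the form of the hull of its
-- list, so inductions involve only finite point sets.
theorem pullingTriangulation_cons (p : EuclideanSpace ℝ (Fin d))
    (l : List (EuclideanSpace ℝ (Fin d)))
    (hni : ¬ AffineIndependent ℝ
      (Subtype.val : {x | x ∈ p :: l} → EuclideanSpace ℝ (Fin d)))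
    (σ : Set (EuclideanSpace ℝ (Fin d))) :
    σ ∈ pullingTriangulation (convexHull ℝ {x | x ∈ p :: l}) (p :: l) ↔
      ∃ f : EuclideanSpace ℝ (Fin d) →ᵃ[ℝ] ℝ, IsFacetFunctional {x | x ∈ p :: l} f ∧ 0 < f p ∧
        ∃ τ ∈ pullingTriangulation (convexHull ℝ {x | x ∈ l.filter (fun x => f x = 0)})
          (l.filter (fun x => f x = 0)), σ = insert p τ := by
  have hfin : {x | x ∈ p :: l}.Finite := List.finite_toSet _
  have hsub := subset_convexHull ℝ {x | x ∈ p :: l}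
  have key : ∀ (F : Set (EuclideanSpace ℝ (Fin d))) (f : EuclideanSpace ℝ (Fin d) →ᵃ[ℝ] ℝ),
      F = {x ∈ convexHull ℝ {x | x ∈ p :: l} | f x = 0} →
      IsFacetFunctional {x | x ∈ p :: l} f → 0 < f p →
      pullingTriangulation F (l.filter (fun x => x ∈ F)) =
        pullingTriangulation (convexHull ℝ {x | x ∈ l.filter (fun x => f x = 0)})
          (l.filter (fun x => f x = 0)) := by
    intro F f hF hf hfp
    congr 1
    · rw [hF, setOf_mem_convexHull_eq_zero hfin hf.1, setOf_mem_filter_eq hfp]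
    · refine List.filter_congr fun x hx => decide_eq_decide.2 ?_
      rw [hF]
      exact and_iff_right (hsub (List.mem_cons_of_mem p hx))
  rw [pullingTriangulation, if_neg hni]
  constructor
  · rintro ⟨F, hF, hpF, τ, hτ, rfl⟩
    obtain ⟨f, hf, hFf⟩ := hF.exists_functional hfin
    have hp : p ∈ {x | x ∈ p :: l} := List.mem_cons_self
    have hfp : 0 < f p := (hf.1 p hp).lt_of_ne' fun h0 => hpF (hFf ▸ ⟨hsub hp, h0⟩)
    exact ⟨f, hf, hfp, τ, by rwa [← key F f hFf hf hfp], rfl⟩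
  · rintro ⟨f, hf, hfp, τ, hτ, rfl⟩
    exact ⟨_, hf.isFacet hfin, fun h => hfp.ne' h.2, τ, by rwa [key _ f rfl hf hfp], rfl⟩

theorem pullingTriangulation_of_affineIndependent (P : Set (EuclideanSpace ℝ (Fin d)))
    {l : List (EuclideanSpace ℝ (Fin d))} (hl : l ≠ [])
    (hi : AffineIndependent ℝ (Subtype.val : {x | x ∈ l} → EuclideanSpace ℝ (Fin d))) :
    pullingTriangulation P l = {{x | x ∈ l}} := by
  obtain ⟨p, l, rfl⟩ := List.exists_cons_of_ne_nil hl
  rw [pullingTriangulation, if_pos hi]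

theorem ne_nil_of_isFacetFunctional {V : Set (EuclideanSpace ℝ (Fin d))}
    {f : EuclideanSpace ℝ (Fin d) →ᵃ[ℝ] ℝ} (hf : IsFacetFunctional V f)
    {l : List (EuclideanSpace ℝ (Fin d))} (hl : {x | x ∈ l} = {x ∈ V | f x = 0}) : l ≠ [] := by
  rintro rfl
  obtain ⟨z, hz⟩ := hf.2.1
  exact List.not_mem_nil (hl.superset hz)

/-- Induction over the simplices of a pulling triangulation. -/
theorem pullingTriangulation_induction
    {C : Set (EuclideanSpace ℝ (Fin d)) → Set (EuclideanSpace ℝ (Fin d)) → Prop}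
    (base : ∀ V : Set (EuclideanSpace ℝ (Fin d)), V.Finite → V.Nonempty →
      AffineIndependent ℝ (Subtype.val : V → EuclideanSpace ℝ (Fin d)) → C V V)
    (step : ∀ (V : Set (EuclideanSpace ℝ (Fin d))) (p : EuclideanSpace ℝ (Fin d))
      (f : EuclideanSpace ℝ (Fin d) →ᵃ[ℝ] ℝ) (σ : Set (EuclideanSpace ℝ (Fin d))), V.Finite →
      p ∈ V → IsFacetFunctional V f → 0 < f p → C {x ∈ V | f x = 0} σ → C V (insert p σ))
    (l : List (EuclideanSpace ℝ (Fin d))) (hl : l ≠ []) (σ : Set (EuclideanSpace ℝ (Fin d)))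
    (hσ : σ ∈ pullingTriangulation (convexHull ℝ {x | x ∈ l}) l) : C {x | x ∈ l} σ := by
  classical
  induction hn : l.length using Nat.strong_induction_on generalizing l σ with
  | _ n ih =>
    by_cases hi : AffineIndependent ℝ (Subtype.val : {x | x ∈ l} → EuclideanSpace ℝ (Fin d))
    · rw [pullingTriangulation_of_affineIndependent _ hl hi, Set.mem_singleton_iff] at hσ
      rw [hσ]
      exact base _ (List.finite_toSet l) (List.exists_mem_of_ne_nil l hl) hi
    · obtain ⟨p, l, rfl⟩ := List.exists_cons_of_ne_nil hl
      obtain ⟨f, hf, hfp, τ, hτ, rfl⟩ := (pullingTriangulation_cons p l hi σ).1 hσ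
      have hset := setOf_mem_filter_eq (l := l) hfp
      refine step _ p f τ (List.finite_toSet _) List.mem_cons_self hf hfp ?_
      rw [← hset]
      refine ih _ ?_ _ (ne_nil_of_isFacetFunctional hf hset) τ hτ rfl
      rw [← hn]
      exact Nat.lt_succ_of_le (List.length_filter_le _ _)

/-- Unimodularity yields a height bound over a facet only if some simplex lies above it. Existence
holds because a list that is not affinely independent has a second point, and hence a facet missing
p. -/
theorem pullingTriangulation_nonempty (l : List (EuclideanSpace ℝ (Fin d))) (hl : l ≠ []) :
    (pullingTriangulation (convexHull ℝ {x | x ∈ l}) l).Nonempty := by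
  classical
  induction hn : l.length using Nat.strong_induction_on generalizing l with
  | _ n ih =>
    by_cases hi : AffineIndependent ℝ (Subtype.val : {x | x ∈ l} → EuclideanSpace ℝ (Fin d))
    · rw [pullingTriangulation_of_affineIndependent _ hl hi]
      exact Set.singleton_nonempty _
    · obtain ⟨p, l, rfl⟩ := List.exists_cons_of_ne_nil hl
      have hp : p ∈ {x | x ∈ p :: l} := List.mem_cons_self
      obtain ⟨q, hq, hpq⟩ : ∃ q ∈ {x | x ∈ p :: l}, p ≠ q := by
        by_contra! h
        have : Subsingleton {x | x ∈ p :: l} :=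
          ⟨fun a b => Subtype.ext ((h a a.2).symm.trans (h b b.2))⟩
        exact hi (affineIndependent_of_subsingleton ℝ _)
      obtain ⟨f, hf, hfp⟩ := exists_isFacetFunctional_pos (List.finite_toSet _) hp hq hpq
      obtain ⟨τ, hτ⟩ := ih _ (by rw [← hn]; exact Nat.lt_succ_of_le (List.length_filter_le _ _))
        (l.filter (fun x => f x = 0))
        (ne_nil_of_isFacetFunctional hf (setOf_mem_filter_eq (l := l) hfp)) rfl
      exact ⟨_, (pullingTriangulation_cons p l hi _).2 ⟨f, hf, hfp, τ, hτ, rfl⟩⟩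

theorem isFullSimplex_of_mem_pullingTriangulation (l : List (EuclideanSpace ℝ (Fin d)))
    (hl : l ≠ []) (σ : Set (EuclideanSpace ℝ (Fin d)))
    (hσ : σ ∈ pullingTriangulation (convexHull ℝ {x | x ∈ l}) l) :
    IsFullSimplex {x | x ∈ l} σ :=
  pullingTriangulation_induction (C := IsFullSimplex) (fun _ => isFullSimplex_self)
    (fun _ _ _ _ _ hp hf hfp hσ => hσ.insert_of_facet hf hp hfp.ne') l hl σ hσ

/-- The simplices of a pulling triangulation of a two-level polytope generate all of its
integral points. -/
theorem sub_mem_vectorSpan_of_mem_pullingTriangulation (l : List (EuclideanSpace ℝ (Fin d)))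
    (hl : l ≠ []) (h2 : IsTwoLevel {x | x ∈ l}) (σ : Set (EuclideanSpace ℝ (Fin d)))
    (hσ : σ ∈ pullingTriangulation (convexHull ℝ {x | x ∈ l}) l) :
    ∀ x ∈ integralPoints {x | x ∈ l}, ∀ q ∈ σ, x - q ∈ vectorSpan ℤ σ := by
  refine (pullingTriangulation_induction (C := fun V σ => IsFullSimplex V σ ∧ (IsTwoLevel V →
    ∀ x ∈ integralPoints V, ∀ q ∈ σ, x - q ∈ vectorSpan ℤ σ)) ?_ ?_ l hl σ hσ).2 h2
  · exact fun V hV hne hi => ⟨isFullSimplex_self hV hne hi, fun _ x hx q hq =>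
      vsub_mem_vectorSpan_of_affineIndependent hV hi hx hq⟩
  · exact fun V p f σ hV hp hf hfp hC => ⟨hC.1.insert_of_facet hf hp hfp.ne', fun h2 x hx q hq =>
      vsub_mem_vectorSpan_insert hV h2 hf hp hfp.ne' hC.1.nonempty hC.1.1
        (hC.2 (h2.facet hV hf)) hx hq⟩

end Pulling

/-! ### Transitive symmetry and equality of heights -/

section Symmetry

variable {d : ℕ}

theorem IsLatticePolytope.eq_convexHull {L : Submodule ℤ (EuclideanSpace ℝ (Fin d))}
    {P : Set (EuclideanSpace ℝ (Fin d))} (hP : IsLatticePolytope L P) :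
    P = convexHull ℝ (latticePoints L P) := by
  obtain ⟨s, -, hs, rfl⟩ := hP
  refine Set.Subset.antisymm (convexHull_mono fun x hx => ⟨subset_convexHull ℝ _ hx, hs x hx⟩) ?_
  exact convexHull_min (fun x hx => hx.1) (convex_convexHull ℝ _)

theorem mem_extremePoints_of_mem_affineSymmetryGroup {P : Set (EuclideanSpace ℝ (Fin d))}
    {g : EuclideanSpace ℝ (Fin d) ≃ᵃ[ℝ] EuclideanSpace ℝ (Fin d)}
    (hg : g ∈ affineSymmetryGroup P) {x : EuclideanSpace ℝ (Fin d)}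
    (hx : x ∈ P.extremePoints ℝ) : g x ∈ P.extremePoints ℝ := by
  have hgP : g '' P = P := hg
  rw [mem_extremePoints] at hx ⊢
  refine ⟨hgP ▸ Set.mem_image_of_mem g hx.1, fun y hy z hz h => ?_⟩
  rw [← hgP] at hy hz
  obtain ⟨y, hy, rfl⟩ := hy
  obtain ⟨z, hz, rfl⟩ := hz
  have himg := image_openSegment ℝ g.toAffineMap y z
  have h' : g x ∈ g.toAffineMap '' openSegment ℝ y z := by rw [himg]; exact h
  obtain ⟨w, hw, hwx⟩ := h'
  have hwx' : w = x := g.injective hwx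
  obtain ⟨h1, h2⟩ := hx.2 y hy z hz (hwx' ▸ hw)
  exact ⟨congrArg g h1, congrArg g h2⟩

/-- If the symmetry group is transitive on the lattice points, these are the vertices. -/
theorem latticePoints_eq_extremePoints {L : Submodule ℤ (EuclideanSpace ℝ (Fin d))}
    {P : Set (EuclideanSpace ℝ (Fin d))} (hP : IsLatticePolytope L P)
    (htrans : ∀ p ∈ latticePoints L P, ∀ q ∈ latticePoints L P,
      ∃ g ∈ affineSymmetryGroup P, g p = q) :
    latticePoints L P = P.extremePoints ℝ := by
  have hsub : P.extremePoints ℝ ⊆ latticePoints L P := by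
    intro x hx
    rw [hP.eq_convexHull] at hx
    exact extremePoints_convexHull_subset hx
  obtain ⟨v, hv⟩ : (P.extremePoints ℝ).Nonempty := by
    obtain ⟨s, hs, -, rfl⟩ := hP
    exact (s.finite_toSet.isCompact_convexHull ℝ).extremePoints_nonempty
      (convexHull_nonempty_iff.2 hs)
  refine Set.Subset.antisymm (fun x hx => ?_) hsub
  obtain ⟨g, hg, rfl⟩ := htrans v (hsub hv) x hx
  exact mem_extremePoints_of_mem_affineSymmetryGroup hg hv

theorem IsFacetFunctional.comp_affineEquiv {E : Type*} [AddCommGroup E] [Module ℝ E] {V : Set E}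
    {f : E →ᵃ[ℝ] ℝ} (hf : IsFacetFunctional V f) (g : E ≃ᵃ[ℝ] E) (hg : g '' V = V) :
    IsFacetFunctional V (f.comp g.toAffineMap) := by
  have hgV : ∀ x ∈ V, g x ∈ V := fun x hx => hg.subset ⟨x, hx, rfl⟩
  refine ⟨fun v hv => hf.1 _ (hgV v hv), ?_, ?_⟩
  · obtain ⟨z, hz, hfz⟩ := hf.2.1
    obtain ⟨y, hy, rfl⟩ := hg.superset hz
    exact ⟨y, hy, hfz⟩
  · have himg : g.toAffineMap '' {x ∈ V | f.comp g.toAffineMap x = 0} = {x ∈ V | f x = 0} := by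
      ext x
      constructor
      · rintro ⟨y, ⟨hy, hfy⟩, rfl⟩
        exact ⟨hgV y hy, hfy⟩
      · rintro ⟨hx, hfx⟩
        obtain ⟨y, hy, rfl⟩ := hg.superset hx
        exact ⟨y, ⟨hy, hfx⟩, rfl⟩
    rw [← hf.2.2, ← himg, ← AffineMap.map_vectorSpan]
    exact congrArg (· + 1) (LinearEquiv.finrank_map_eq g.linear _).symm

/-- Only the first pulled point is controlled by the triangulation; transitivity spreads the bound
to all points. Affine dependence ensures that the recursion does pull this point. -/
theorem isTwoLevel_of_isUnimodular {L : Submodule ℤ (EuclideanSpace ℝ (Fin d))}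
    {P : Set (EuclideanSpace ℝ (Fin d))} (hP : IsLatticePolytope L P)
    (htrans : ∀ p ∈ latticePoints L P, ∀ q ∈ latticePoints L P,
      ∃ g ∈ affineSymmetryGroup P, g p = q)
    (hni : ¬ AffineIndependent ℝ
      (Subtype.val : latticePoints L P → EuclideanSpace ℝ (Fin d)))
    {T : Set (Set (EuclideanSpace ℝ (Fin d)))} (hT : IsPullingTriangulation L P T)
    (hu : IsUnimodular L P T) : IsTwoLevel (latticePoints L P) := by
  classical
  obtain ⟨l, ⟨-, hl⟩, rfl⟩ := hT
  have hV : {x | x ∈ l} = latticePoints L P := Set.ext hl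
  have hPV := hP.eq_convexHull
  have hdim : dim P = Module.finrank ℝ (vectorSpan ℝ (latticePoints L P)) := by
    conv_lhs => rw [hPV]
    exact dim_convexHull _
  have hl0 : l ≠ [] := by
    rintro rfl
    have : IsEmpty (latticePoints L P) := ⟨fun x => List.not_mem_nil ((hl x).2 x.2)⟩
    exact hni (affineIndependent_of_subsingleton ℝ _)
  obtain ⟨p, l, rfl⟩ := List.exists_cons_of_ne_nil hl0
  have hp : p ∈ latticePoints L P := (hl p).1 List.mem_cons_self
  have hmin : ∀ f : EuclideanSpace ℝ (Fin d) →ᵃ[ℝ] ℝ,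
      IsFacetFunctional (latticePoints L P) f → f p ≠ 0 →
      ∀ q ∈ latticePoints L P, f q ≠ 0 → f p ≤ f q := by
    intro f hf hfp q hq hfq
    have hfp' : 0 < f p := (hf.1 p hp).lt_of_ne' hfp
    have hset := setOf_mem_filter_eq (l := l) hfp'
    have hl0' := ne_nil_of_isFacetFunctional (hV ▸ hf) hset
    obtain ⟨σ, hσ⟩ := pullingTriangulation_nonempty _ hl0'
    have hσf := isFullSimplex_of_mem_pullingTriangulation _ hl0' σ hσ
    rw [hset, hV] at hσf
    have hσT : insert p σ ∈ pullingTriangulation P (p :: l) := by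
      rw [hPV, ← hV, pullingTriangulation_cons p l (by rwa [hV])]
      exact ⟨f, by rwa [hV], hfp', σ, hσ, rfl⟩
    have hpσ := hσf.insert_of_facet hf hp hfp
    have hqσ := hσf.insert_of_facet hf hq hfq
    -- Exchanging the apex p for q gives a competing lattice simplex over the same base.
    have hle := (hu _ hσT).2 ⟨insert q σ, ⟨hqσ.1, by rw [hdim]; exact hqσ.2.1, hqσ.2.2⟩, rfl⟩
    exact height_le_of_measure_convexHull_le hσf.nonempty (by rw [hdim]; exact hpσ.2.1) hpσ.2.2 f
      (fun x hx => (hσf.1 hx).2) hfp' (hf.1 q hq)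
      (hpσ.affineSpan_eq ▸ subset_affineSpan ℝ _ hq) hle
  have hle : ∀ f : EuclideanSpace ℝ (Fin d) →ᵃ[ℝ] ℝ,
      IsFacetFunctional (latticePoints L P) f → ∀ r ∈ latticePoints L P,
      ∀ q ∈ latticePoints L P, f r ≠ 0 → f q ≠ 0 → f r ≤ f q := by
    intro f hf r hr q hq hfr hfq
    obtain ⟨g, hg, rfl⟩ := htrans p hp r hr
    have hgP : g '' P = P := hg
    -- g is not assumed to preserve `L`; it permutes the lattice points because they are the extreme
    -- points.
    have hgV : g '' latticePoints L P = latticePoints L P := by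
      have hext := latticePoints_eq_extremePoints hP htrans
      refine Set.Subset.antisymm ?_ fun x hx => ⟨g⁻¹ x, ?_, g.apply_symm_apply x⟩
      · rintro _ ⟨x, hx, rfl⟩
        rw [hext] at hx ⊢
        exact mem_extremePoints_of_mem_affineSymmetryGroup hg hx
      · rw [hext] at hx ⊢
        exact mem_extremePoints_of_mem_affineSymmetryGroup (inv_mem hg) hx
    obtain ⟨s, hs, rfl⟩ := hgV.superset hq
    -- The pulled-back functional f ∘ g has value f r at p and f q at s.
    exact hmin _ (hf.comp_affineEquiv g hgV) hfr s hs hfq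
  exact fun f hf r hr q hq hfr hfq =>
    le_antisymm (hle f hf r hr q hq hfr hfq) (hle f hf q hq r hr hfq hfr)

end Symmetry

/-- Lattice points are integral points, so each simplex of a pulling triangulation generates the
vertex differences of every competitor, which bounds its volume from above. Symmetry plays no role
here. -/
theorem isCompressed_of_isTwoLevel {d : ℕ} {L : Submodule ℤ (EuclideanSpace ℝ (Fin d))}
    {P : Set (EuclideanSpace ℝ (Fin d))} (hP : IsLatticePolytope L P)
    (hne : (latticePoints L P).Nonempty) (h2 : IsTwoLevel (latticePoints L P)) :
    IsCompressed L P := by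
  rintro _ ⟨l, ⟨-, hl⟩, rfl⟩ σ hσ
  have hV : {x | x ∈ l} = latticePoints L P := Set.ext hl
  have hPV := hP.eq_convexHull
  have hdim : dim P = Module.finrank ℝ (vectorSpan ℝ (latticePoints L P)) := by
    conv_lhs => rw [hPV]
    exact dim_convexHull _
  have hl0 : l ≠ [] := by
    rintro rfl
    exact List.not_mem_nil ((hl _).2 hne.some_mem)
  rw [hPV, ← hV] at hσ
  have hfull := isFullSimplex_of_mem_pullingTriangulation l hl0 σ hσ
  have hspan := sub_mem_vectorSpan_of_mem_pullingTriangulation l hl0 (hV ▸ h2) σ hσ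
  rw [hV] at hfull hspan
  have hcard : σ.ncard = dim P + 1 := by rw [hdim]; exact hfull.2.1
  refine ⟨⟨σ, ⟨hfull.1, hcard, hfull.2.2⟩, rfl⟩, ?_⟩
  rintro _ ⟨τ, ⟨hτ, hτcard, hτi⟩, rfl⟩
  exact measure_convexHull_le_of_integral hcard hτcard hτi fun x hx q hq =>
    hspan x (subset_integralPoints _ (hτ hx)) q hq

end LatticePolytope

end

theorem corollary2p5 {d : ℕ} (L : Submodule ℤ (EuclideanSpace ℝ (Fin d))) [DiscreteTopology L]
    (P : Set (EuclideanSpace ℝ (Fin d))) (hP : LatticePolytope.IsLatticePolytope L P)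
    (htrans : ∀ p ∈ LatticePolytope.latticePoints L P, ∀ q ∈ LatticePolytope.latticePoints L P,
      ∃ g ∈ LatticePolytope.affineSymmetryGroup P, g p = q) :
    LatticePolytope.IsCompressed L P ∨
      ∀ T, LatticePolytope.IsPullingTriangulation L P T →
        ¬ LatticePolytope.IsUnimodular L P T := by
  refine or_iff_not_imp_right.2 fun h => ?_
  push Not at h
  obtain ⟨T, hT, hu⟩ := h
  have hne : (LatticePolytope.latticePoints L P).Nonempty := by
    obtain ⟨s, ⟨x, hx⟩, hs, rfl⟩ := hP
    exact ⟨x, subset_convexHull ℝ _ hx, hs x hx⟩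
  -- When the lattice points form a simplex, all orderings give the same triangulation, so one being
  -- unimodular suffices.
  by_cases hi : AffineIndependent ℝ
      (Subtype.val : LatticePolytope.latticePoints L P → EuclideanSpace ℝ (Fin d))
  · have huniq : ∀ T, LatticePolytope.IsPullingTriangulation L P T →
        T = {LatticePolytope.latticePoints L P} := by
      rintro _ ⟨l, ⟨-, hl⟩, rfl⟩
      have hV : {x | x ∈ l} = LatticePolytope.latticePoints L P := Set.ext hl
      have hl0 : l ≠ [] := by
        rintro rfl
        exact List.not_mem_nil ((hl _).2 hne.some_mem)
      rw [LatticePolytope.pullingTriangulation_of_affineIndependent P hl0 (by rwa [hV]), hV]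
    intro T' hT'
    rwa [huniq T' hT', ← huniq T hT]
  · exact LatticePolytope.isCompressed_of_isTwoLevel hP hne
      (LatticePolytope.isTwoLevel_of_isUnimodular hP htrans hi hT hu)
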